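/- **Proposition (Inverse GLA).** Let $\mathscr F$ be a complex vector space with the Hausdorff locally convex topology generated by a separating family of seminorms; assume that $\mathscr F$ is separable and locally sequentially weakly compact (every bounded sequence in $\mathscr F$ has a subsequence converging weakly to an element of $\mathscr F$). Let $(\mathscr S,\Sigma,\mu)$ be an equicontinuous spectral measure triple on $\mathscr F$: $\mu$ maps the $\sigma$-algebra $\Sigma$ of subsets of $\mathscr S$ into the continuous linear operators on $\mathscr F$, is countably additive in the weak operator topology, satisfies $\mu(\mathscr S)=I$ and $\mu(A_1\cap A_2)=\mu(A_1)\mu(A_2)$, and for every continuous seminorm $p$ there is a continuous seminorm $q$ with $p(\mu(A)\psi)\le q(\psi)$ for all $A\in\Sigma$, $\psi\in\mathscr F$. Let $f:\mathscr S\to\mathbb C$ be bounded and $\Sigma$-measurable, $U=\int_{\mathscr S} f\,d\mu$ (the strong limit of the integrals of simple functions converging uniformly to $f$), and $E(B)=\mu(f^{-1}(B))$ for Borel sets $B\subseteq\mathbb C$. The spectrum $\sigma(U)$ is the complement of the set of $\xi\in\mathbb C$ for which $\xi I-U$ has dense image and is injective with continuous inverse on its image; the point spectrum $\sigma_p(U)$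 is the set of $\xi\in\sigma(U)$ for which $\xi I-U$ is not injective. For $r>0$ let $\mathbb D_r=\{|z|<r\}$. Assume that: 1. ($U$ has minimal point spectrum.) With $\sigma'=\{\xi^{-1}:\xi\in\sigma(U)\}$ and $\sigma_p'=\{\xi^{-1}:\xi\in\sigma_p(U)\}$ there is $R>0$ such that $\sigma'\setminus\mathbb D_R\ne\emptyset$ and for every $r>R$: if $\mathbb D_r\cap\sigma_p'\neq\emptyset$, then some $\eta\in\mathbb D_r\cap\sigma'$ satisfies $|\eta|=\sup\{|\zeta|:\zeta\in\mathbb D_r\cap\sigma'\}$; and $\sigma'\setminus\mathbb D_r\subseteq\sigma'_p$. 2. (The point spectrum is concentrated on isolated circles.) Every point of the set $\{|f(s)| : s\in\mathscr S,\ f(s)I-U\text{ is not injective}\}\subset\mathbb R$ is an isolated point of this set. 3. There is a constant $C>0$ with $|\xi|\ge C^{-1}$ for all $\xi\in\sigma(U)$. Then $U$ has a continuous inverse $U^{-1}$ on $\mathscr F$, and for every $\lambda\in\sigma_p(U)$ $$E(\{\lambda\})=\lim_{n\to\infty}A_n\bigl(\lambda U^{-1}(I-E(\Omega))\bigr),\qquad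 A_n(V)=\frac1n\sum_{k=0}^{n-1}V^k,$$ in the strong operator topology, where $\Omega=\{\xi\in\sigma(U):|\xi|<|\lambda|\}$. Here $E$ is regarded as a measure on $\sigma(U)$: $E(\Omega)$ means $E(B)$ for any Borel set $B\subseteq\mathbb C$ with $B\cap\sigma(U)=\Omega$ (for instance $B=\mathbb D_{|\lambda|}$, or $B=\Omega$ if $\Omega$ is Borel), and the assertion holds for every such $B$. -/

import Mathlib

open Filter Topology

/-- A spectral measure triple `(S, Σ, μ)` on `F`: a set function from the `σ`-algebra `Σ` of `S`
to the continuous linear operators on `F` that is countably additive in the weak operator topology,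
normalised by `μ(S) = I` and multiplicative on intersections.  (Values on non-measurable sets play
no role.) -/
structure SpectralMeasure (S F : Type*) [MeasurableSpace S] [AddCommGroup F] [Module ℂ F]
    [TopologicalSpace F] where
  toFun : Set S → F →L[ℂ] F
  countably_additive : ∀ A : ℕ → Set S, (∀ i, MeasurableSet (A i)) →
    Pairwise (fun i j => Disjoint (A i) (A j)) →
    ∀ (x : F) (φ : F →L[ℂ] ℂ), HasSum (fun i => φ (toFun (A i) x)) (φ (toFun (⋃ i, A i) x))
  map_univ : toFun Set.univ = ContinuousLinearMap.id ℂ F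
  map_inter : ∀ A B : Set S, MeasurableSet A → MeasurableSet B →
    toFun (A ∩ B) = (toFun A).comp (toFun B)

namespace SpectralMeasure

variable {S T F : Type*} [MeasurableSpace S] [MeasurableSpace T] [AddCommGroup F] [Module ℂ F]
  [TopologicalSpace F]

instance : CoeFun (SpectralMeasure S F) (fun _ => Set S → F →L[ℂ] F) := ⟨SpectralMeasure.toFun⟩

/-- The operators `μ(A)`, `A ∈ Σ`, form an equicontinuous family. -/
def IsEquicontinuous (μ : SpectralMeasure S F) : Prop :=
  ∀ p : Seminorm ℂ F, Continuous p → ∃ q : Seminorm ℂ F, Continuous q ∧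
    ∀ A : Set S, MeasurableSet A → ∀ x : F, p (μ A x) ≤ q x

/-- Change of measure: the spectral measure `B ↦ μ(f⁻¹(B))`. -/
def map (μ : SpectralMeasure S F) (f : S → T) (hf : Measurable f) : SpectralMeasure T F where
  toFun B := μ (f ⁻¹' B)
  countably_additive A hA hd x φ := by
    have h := μ.countably_additive (fun i => f ⁻¹' A i) (fun i => hf (hA i))
      (fun i j hij => (hd hij).preimage f) x φ
    simpa only [Set.preimage_iUnion] using h
  map_univ := by simpa only [Set.preimage_univ] using μ.map_univ
  map_inter A B hA hB := by
    simpa only [Set.preimage_inter] using μ.map_inter _ _ (hf hA) (hf hB)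

variable [IsTopologicalAddGroup F] [ContinuousSMul ℂ F]

/-- The integral `∑ c, c • μ(g = c)` of a simple function. -/
noncomputable def simpleIntegral (μ : SpectralMeasure S F) (g : MeasureTheory.SimpleFunc S ℂ) :
    F →L[ℂ] F :=
  ∑ c ∈ g.range, c • μ (g ⁻¹' {c})

/-- `U = ∫ f dμ`: the operator `U` is the strong limit of the integrals of simple functions that
converge uniformly to `f`.  (For an equicontinuous `μ` the limit does not depend on the sequence of
simple functions, and it exists for all bounded measurable `f` if `F` is sequentially complete.) -/
def HasIntegral (μ : SpectralMeasure S F) (f : S → ℂ) (U : F →L[ℂ] F) : Prop :=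
  ∃ g : ℕ → MeasureTheory.SimpleFunc S ℂ, TendstoUniformly (fun n s => g n s) f atTop ∧
    ∀ x : F, Tendsto (fun n => μ.simpleIntegral (g n) x) atTop (𝓝 (U x))

end SpectralMeasure

/-- Local sequential weak compactness: every bounded sequence has a subsequence that converges
weakly to an element of the space. -/
def LocallySeqWeaklyCompact (F : Type*) [AddCommGroup F] [Module ℂ F] [TopologicalSpace F] : Prop :=
  ∀ x : ℕ → F, Bornology.IsVonNBounded ℂ (Set.range x) →
    ∃ (y : F) (k : ℕ → ℕ), StrictMono k ∧
      ∀ φ : F →L[ℂ] ℂ, Tendsto (fun n => φ (x (k n))) atTop (𝓝 (φ y))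

section Spectrum

variable {F : Type*} [AddCommGroup F] [Module ℂ F] [TopologicalSpace F] [IsTopologicalAddGroup F]
  [ContinuousSMul ℂ F]

/-- The operator `ξ I - U`. -/
def shiftedOp (U : F →L[ℂ] F) (ξ : ℂ) : F →L[ℂ] F :=
  ξ • ContinuousLinearMap.id ℂ F - U

/-- The resolvent set: all `ξ` for which `ξ I - U` has dense image and a continuous inverse on its
image (it is injective, and a homeomorphism onto its image). -/
def lcResolventSet (U : F →L[ℂ] F) : Set ℂ :=
  {ξ | DenseRange (shiftedOp U ξ) ∧ IsEmbedding (shiftedOp U ξ)}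

/-- The spectrum `σ(U)`. -/
def lcSpectrum (U : F →L[ℂ] F) : Set ℂ := (lcResolventSet U)ᶜ

/-- The point spectrum `σ_p(U)`: the points of the spectrum for which `ξ I - U` has no inverse,
that is, is not injective. -/
def pointSpectrum (U : F →L[ℂ] F) : Set ℂ :=
  {ξ ∈ lcSpectrum U | ¬ Function.Injective (shiftedOp U ξ)}

/-- The elements of `A` whose modulus equals `sup_{ξ ∈ A} |ξ|`. -/
def peripheralPart (A : Set ℂ) : Set ℂ :=
  {ξ ∈ A | IsLUB ((fun z : ℂ => ‖z‖) '' A) ‖ξ‖}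

/-- A spectrum `σ` with set of eigenvalues `σp` has dominating point spectrum. -/
def HasDominatingPointSpectrum (σ σp : Set ℂ) : Prop :=
  ∃ R : ℝ, 0 < R ∧ (σ \ Metric.ball 0 R).Nonempty ∧ ∀ r : ℝ, R < r →
    ((Metric.ball 0 r ∩ σ ∩ σp).Nonempty → (peripheralPart (Metric.ball 0 r ∩ σ)).Nonempty) ∧
    σ \ Metric.ball 0 r ⊆ σp

/-- `U` has minimal point spectrum: the inverted spectrum `{ξ⁻¹ | ξ ∈ σ(U)}`, whose eigenvalues are
the inverses of the eigenvalues of `U`, is dominating.  Only used for `0 ∉ σ(U)`, so that no point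
is inverted to infinity. -/
def HasMinimalPointSpectrum (U : F →L[ℂ] F) : Prop :=
  HasDominatingPointSpectrum ((fun ξ : ℂ => ξ⁻¹) '' lcSpectrum U)
    ((fun ξ : ℂ => ξ⁻¹) '' pointSpectrum U)

/-- The point spectrum of `U = ∫ f dμ` is concentrated on isolated circles: every point of the set
of all moduli `|f(s)|` for which `f(s) I - U` has no inverse is an isolated point of that set. -/
def PointSpectrumOnIsolatedCircles {S : Type*} (f : S → ℂ) (U : F →L[ℂ] F) : Prop :=
  ∀ r ∈ {r : ℝ | ∃ s : S, ‖f s‖ = r ∧ ¬ Function.Injective (shiftedOp U (f s))},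
    ¬ AccPt r (𝓟 {r : ℝ | ∃ s : S, ‖f s‖ = r ∧ ¬ Function.Injective (shiftedOp U (f s))})

/-- The averages `A_n(V) = n⁻¹ ∑_{k=0}^{n-1} V^k`. -/
noncomputable def averageOp (n : ℕ) (V : F →L[ℂ] F) : F →L[ℂ] F :=
  (n : ℂ)⁻¹ • ∑ k ∈ Finset.range n, V ^ k

end Spectrum

/-!
The spectral measure is concentrated on `σ(U)`. Indeed, if `ξ` is in the resolvent set, then every
power of `ξ - U` is an embedding, so the part of `μ` carried by `f⁻¹(A)` with `A` in the disc of
radius `r` about `ξ` is `O(rⁿ)` for all `n`. A finite measure on the plane does not charge a set of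
points at which it is `O(r³)`, because the density of Lebesgue measure with respect to it is
infinite there.

Since `0 ∉ σ(U)`, it follows that `f ≠ 0` almost everywhere. If simple functions `gₙ` approximate
`1 / f`, then `U (∫ gₙ dμ) x → x`; as `U` is an embedding, the vectors `(∫ gₙ dμ) x` are bounded,
and a weak subsequential limit of them is a preimage of `x`. Hence `U` is invertible.

Finally `λ U⁻¹ (I - E(Ω))` is the integral of `λ / f` cut off to `0` where `|f| < |λ|`. This
function is bounded by `1`, so the averages of its powers are bounded by `1` and converge pointwise
to the indicator function of `f = λ`; bounded convergence for `μ` gives the limit.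
-/

section LocallyConvex

variable {𝕜 E : Type*} [RCLike 𝕜] [AddCommGroup E] [Module 𝕜 E] [TopologicalSpace E]

theorem tendsto_zero_iff_forall_continuous_seminorm [PolynormableSpace 𝕜 E] {ι : Type*}
    {l : Filter ι} {u : ι → E} :
    Tendsto u l (𝓝 0) ↔
      ∀ p : Seminorm 𝕜 E, Continuous p → Tendsto (fun i => p (u i)) l (𝓝 0) := by
  refine ⟨fun h p hp => by simpa [Function.comp_def] using (hp.tendsto 0).comp h, fun h => ?_⟩
  rw [(PolynormableSpace.withSeminorms 𝕜 E).tendsto_nhds]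
  rintro ⟨p, hp⟩ ε hε
  simpa using (h p hp).eventually (gt_mem_nhds hε)

theorem isVonNBounded_of_image_of_isInducing {G : Type*} [AddCommGroup G] [Module 𝕜 G]
    [TopologicalSpace G] {T : E →ₗ[𝕜] G} (hT : IsInducing T) {s : Set E}
    (hs : Bornology.IsVonNBounded 𝕜 (T '' s)) : Bornology.IsVonNBounded 𝕜 s := by
  intro V hV
  rw [hT.nhds_eq_comap, map_zero] at hV
  obtain ⟨W, hW, hWV⟩ := hV
  filter_upwards [hs hW, Bornology.eventually_ne_cobounded 0] with a ha ha0 x hx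
  rw [Set.mem_smul_set_iff_inv_smul_mem₀ ha0]
  apply hWV
  rw [Set.mem_preimage, map_smul, ← Set.mem_smul_set_iff_inv_smul_mem₀ ha0]
  exact ha ⟨x, hx, rfl⟩

theorem isInvertible_of_isEmbedding_of_surjective {G : Type*} [AddCommGroup G] [Module 𝕜 G]
    [TopologicalSpace G] {T : E →L[𝕜] G} (hT : IsEmbedding T)
    (hs : Function.Surjective T) : T.IsInvertible := by
  let e : E ≃ₗ[𝕜] G := LinearEquiv.ofBijective (T : E →ₗ[𝕜] G) ⟨hT.injective, hs⟩
  have he : T ∘ e.symm = id := funext e.apply_symm_apply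
  exact ⟨⟨e, T.continuous, hT.isInducing.continuous_iff.2 (he ▸ continuous_id)⟩, rfl⟩

theorem separatingDual_of_polynormableSpace [PolynormableSpace 𝕜 E] [T1Space E] :
    SeparatingDual 𝕜 E where
  exists_ne_zero' x hx := by
    have hE := PolynormableSpace.withSeminorms 𝕜 E
    have := hE.topologicalAddGroup
    have := hE.continuousSMul
    let _ : Module ℝ E := .restrictScalars ℝ 𝕜 E
    have : IsScalarTower ℝ 𝕜 E := .restrictScalars ℝ 𝕜 E
    have := hE.toLocallyConvexSpace
    obtain ⟨φ, hφ⟩ := RCLike.geometric_hahn_banach_point_point (𝕜 := 𝕜) hx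
    exact ⟨φ, fun h => by simp [h] at hφ⟩

variable [IsTopologicalAddGroup E] [ContinuousSMul 𝕜 E] [Module ℝ E] [IsScalarTower ℝ 𝕜 E]
  [LocallyConvexSpace ℝ E]

theorem mem_of_isClosed_of_tendsto_dual {C : Set E} (hconv : Convex ℝ C) (hC : IsClosed C)
    {ι : Type*} {l : Filter ι} [l.NeBot] {u : ι → E} (hu : ∀ i, u i ∈ C) {x : E}
    (hx : ∀ φ : E →L[𝕜] 𝕜, Tendsto (fun i => φ (u i)) l (𝓝 (φ x))) : x ∈ C := by
  by_contra hxC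
  obtain ⟨φ, c, hφ, hc⟩ := RCLike.geometric_hahn_banach_closed_point (𝕜 := 𝕜) hconv hC hxC
  exact hc.not_ge (le_of_tendsto ((RCLike.continuous_re.tendsto _).comp (hx φ))
    (Eventually.of_forall fun i => (hφ _ (hu i)).le))

end LocallyConvex

section ConvexBounds

variable {ι : Type*} [Fintype ι]

theorem seminorm_sum_real_smul_le {E : Type*} [AddCommGroup E] [Module ℝ E] (p : Seminorm ℝ E)
    (v : ι → E) {M : ℝ} (h : ∀ I : Finset ι, p (∑ i ∈ I, v i) ≤ M) {K : ℝ} (hK : 0 ≤ K)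
    {t : ι → ℝ} (ht : ∀ i, |t i| ≤ K) : p (∑ i, t i • v i) ≤ 2 * K * M := by
  classical
  -- The seminorm is convex in `t`, so it is dominated by its values at the vertices of the cube.
  have hmem : t ∈ convexHull ℝ (Set.univ.pi fun _ : ι => {-K, K}) := by
    refine mem_convexHull_pi fun i _ => ?_
    rw [convexHull_pair, segment_eq_Icc (by linarith)]
    exact abs_le.1 (ht i)
  have hconv : ConvexOn ℝ Set.univ (p ∘ Fintype.linearCombination ℝ v) :=
    p.convexOn.comp_linearMap _
  obtain ⟨ε, hε, hle⟩ := hconv.exists_ge_of_mem_convexHull (Set.subset_univ _) hmem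
  have hsum : ∑ i, ε i • v i =
      K • (∑ i with ε i = K, v i - ∑ i with ¬ ε i = K, v i) := by
    rw [← Finset.sum_filter_add_sum_filter_not _ (fun i => ε i = K), smul_sub, sub_eq_add_neg,
      Finset.smul_sum, Finset.smul_sum, ← Finset.sum_neg_distrib]
    congr 1 <;> refine Finset.sum_congr rfl fun i hi => ?_
    · rw [(Finset.mem_filter.1 hi).2]
    · rw [(hε i trivial).resolve_right (Finset.mem_filter.1 hi).2, neg_smul]
  calc p (∑ i, t i • v i) ≤ p (∑ i, ε i • v i) := by
        simpa [Fintype.linearCombination_apply] using hle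
    _ ≤ K * (M + M) := by
        rw [hsum, map_smul_eq_mul, Real.norm_of_nonneg hK]
        exact mul_le_mul_of_nonneg_left ((map_sub_le_add p _ _).trans (add_le_add (h _) (h _))) hK
    _ = 2 * K * M := by ring

theorem seminorm_sum_complex_smul_le {E : Type*} [AddCommGroup E] [Module ℂ E] (p : Seminorm ℂ E)
    (v : ι → E) {M : ℝ} (h : ∀ I : Finset ι, p (∑ i ∈ I, v i) ≤ M) {K : ℝ} (hK : 0 ≤ K)
    {c : ι → ℂ} (hc : ∀ i, ‖c i‖ ≤ K) : p (∑ i, c i • v i) ≤ 4 * K * M := by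
  have hre := seminorm_sum_real_smul_le (p.restrictScalars ℝ) v h hK
    fun i => (Complex.abs_re_le_norm (c i)).trans (hc i)
  have him := seminorm_sum_real_smul_le (p.restrictScalars ℝ) v h hK
    fun i => (Complex.abs_im_le_norm (c i)).trans (hc i)
  have hsum : ∑ i, c i • v i = ∑ i, (c i).re • v i + Complex.I • ∑ i, (c i).im • v i := by
    rw [Finset.smul_sum, ← Finset.sum_add_distrib]
    refine Finset.sum_congr rfl fun i _ => ?_
    rw [← Complex.coe_smul, ← Complex.coe_smul, smul_smul, ← add_smul, mul_comm Complex.I,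
      Complex.re_add_im]
  calc p (∑ i, c i • v i)
      ≤ p (∑ i, (c i).re • v i) + p (Complex.I • ∑ i, (c i).im • v i) :=
        hsum ▸ map_add_le_add p _ _
    _ ≤ 2 * K * M + 2 * K * M := by
        rw [map_smul_eq_mul, Complex.norm_I, one_mul]
        exact add_le_add hre him
    _ = 4 * K * M := by ring

end ConvexBounds

namespace SpectralMeasure

open MeasureTheory

variable {S F : Type*} [MeasurableSpace S] [AddCommGroup F] [Module ℂ F] [TopologicalSpace F]

section WeaklyAdditive

variable (μ : SpectralMeasure S F)

theorem dual_apply_empty (x : F) (φ : F →L[ℂ] ℂ) : φ (μ ∅ x) = 0 := by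
  have h := μ.countably_additive (fun _ => ∅) (fun _ => .empty) (fun _ _ _ => disjoint_bot_left) x φ
  exact (summable_const_iff _).1 h.summable

open Classical in
/-- The complex measure `A ↦ φ (μ(A) x)`, to which scalar measure theory applies. Like every
vector measure it is set to `0` on non-measurable sets. -/
noncomputable def scalarMeasure (x : F) (φ : F →L[ℂ] ℂ) : VectorMeasure S ℂ where
  measureOf' A := if MeasurableSet A then φ (μ A x) else 0
  empty' := by simp [μ.dual_apply_empty]
  not_measurable' A hA := by simp [hA]
  m_iUnion' A hA hd := by
    simpa [hA, MeasurableSet.iUnion hA] using μ.countably_additive A hA hd x φ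

theorem scalarMeasure_apply (x : F) (φ : F →L[ℂ] ℂ) {A : Set S} (hA : MeasurableSet A) :
    μ.scalarMeasure x φ A = φ (μ A x) :=
  if_pos hA

end WeaklyAdditive

section FiniteAdditivity

variable [SeparatingDual ℂ F] (μ : SpectralMeasure S F)

theorem apply_empty : μ ∅ = 0 := by
  ext x
  exact SeparatingDual.eq_zero_of_forall_dual_eq_zero (μ.dual_apply_empty x)

variable [IsTopologicalAddGroup F]

theorem apply_union {A B : Set S} (hA : MeasurableSet A) (hB : MeasurableSet B)
    (h : Disjoint A B) : μ (A ∪ B) = μ A + μ B := by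
  ext x
  refine (SeparatingDual.eq_iff_forall_dual_eq (R := ℂ)).2 fun φ => ?_
  simpa [scalarMeasure_apply, hA, hB] using (μ.scalarMeasure x φ).of_union h hA hB

theorem apply_biUnion_finset {ι : Type*} {s : Finset ι} {A : ι → Set S}
    (hd : (s : Set ι).PairwiseDisjoint A) (hA : ∀ i, MeasurableSet (A i)) :
    μ (⋃ i ∈ s, A i) = ∑ i ∈ s, μ (A i) := by
  ext x
  refine (SeparatingDual.eq_iff_forall_dual_eq (R := ℂ)).2 fun φ => ?_
  simpa [scalarMeasure_apply, hA, s.measurableSet_biUnion fun i _ => hA i] using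
    (μ.scalarMeasure x φ).of_biUnion_finset hd fun i _ => hA i

theorem apply_compl {A : Set S} (hA : MeasurableSet A) :
    μ Aᶜ = ContinuousLinearMap.id ℂ F - μ A := by
  rw [← μ.map_univ, ← Set.union_compl_self A, μ.apply_union hA hA.compl disjoint_compl_right]
  abel

theorem apply_preimage_finset {β : Type*} (k : SimpleFunc S β) (s : Finset β) :
    μ (k ⁻¹' s) = ∑ b ∈ s, μ (k ⁻¹' {b}) := by
  rw [← Set.biUnion_preimage_singleton]
  exact μ.apply_biUnion_finset
    (fun _ _ _ _ hab => (Set.disjoint_singleton.2 hab).preimage k) k.measurableSet_fiber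

variable [ContinuousSMul ℂ F]

theorem simpleIntegral_map {β : Type*} (k : SimpleFunc S β) (g : β → ℂ) {s : Finset β}
    (hs : k.range ⊆ s) : μ.simpleIntegral (k.map g) = ∑ b ∈ s, g b • μ (k ⁻¹' {b}) := by
  classical
  have hrange : ∑ b ∈ k.range, g b • μ (k ⁻¹' {b}) = ∑ b ∈ s, g b • μ (k ⁻¹' {b}) :=
    Finset.sum_subset hs fun b _ hb => by
      rw [(k.preimage_eq_empty_iff b).2 hb, μ.apply_empty, smul_zero]
  rw [← hrange, simpleIntegral, SimpleFunc.range_map,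
    ← Finset.sum_fiberwise_of_maps_to (fun b hb => Finset.mem_image_of_mem g hb)]
  refine Finset.sum_congr rfl fun c _ => ?_
  rw [k.map_preimage_singleton, apply_preimage_finset, Finset.smul_sum]
  exact Finset.sum_congr rfl fun b hb => by rw [(Finset.mem_filter.1 hb).2]

theorem simpleIntegral_mul (g h : SimpleFunc S ℂ) :
    μ.simpleIntegral (g * h) = μ.simpleIntegral g ∘L μ.simpleIntegral h := by
  have hrange : (g.pair h).range ⊆ g.range ×ˢ h.range := fun b hb => by
    obtain ⟨x, rfl⟩ := SimpleFunc.mem_range.1 hb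
    simp
  rw [g.mul_eq_map₂ h, μ.simpleIntegral_map _ _ hrange, Finset.sum_product]
  ext x
  simp only [simpleIntegral, SimpleFunc.pair_preimage_singleton,
    μ.map_inter _ _ (g.measurableSet_fiber _) (h.measurableSet_fiber _), sum_apply, smul_apply,
    ContinuousLinearMap.comp_apply, map_sum, map_smul, Finset.smul_sum]
  rw [Finset.sum_comm]
  simp only [smul_smul, mul_comm]

theorem simpleIntegral_add (g h : SimpleFunc S ℂ) :
    μ.simpleIntegral (g + h) = μ.simpleIntegral g + μ.simpleIntegral h := by
  have hg := μ.simpleIntegral_map (g.pair h) Prod.fst subset_rfl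
  have hh := μ.simpleIntegral_map (g.pair h) Prod.snd subset_rfl
  rw [SimpleFunc.map_fst_pair] at hg
  rw [SimpleFunc.map_snd_pair] at hh
  rw [g.add_eq_map₂ h, μ.simpleIntegral_map _ _ subset_rfl, hg, hh, ← Finset.sum_add_distrib]
  simp only [add_smul]

theorem simpleIntegral_smul (c : ℂ) (g : SimpleFunc S ℂ) :
    μ.simpleIntegral (c • g) = c • μ.simpleIntegral g := by
  rw [g.smul_eq_map c, μ.simpleIntegral_map g _ subset_rfl, simpleIntegral, Finset.smul_sum]
  simp only [smul_eq_mul, smul_smul]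

theorem simpleIntegral_piecewise_const {A : Set S} (hA : MeasurableSet A) (c : ℂ) :
    μ.simpleIntegral (.piecewise A hA (.const S c) (.const S 0)) = c • μ A := by
  classical
  let k : SimpleFunc S Bool := .piecewise A hA (.const S true) (.const S false)
  have hmap : .piecewise A hA (.const S c) (.const S 0) = k.map fun b => if b then c else 0 := by
    ext x
    by_cases hx : x ∈ A <;> simp [k, hx]
  have hfiber : k ⁻¹' {true} = A := by
    ext x
    by_cases hx : x ∈ A <;> simp [k, hx]
  rw [hmap, μ.simpleIntegral_map k _ (Finset.subset_univ _)]
  simp [hfiber]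

theorem seminorm_simpleIntegral_le (p : Seminorm ℂ F) {x : F} {M K : ℝ}
    (hM : ∀ A, MeasurableSet A → p (μ A x) ≤ M) (hK : 0 ≤ K) {g : SimpleFunc S ℂ}
    (hg : ∀ s, ‖g s‖ ≤ K) : p (μ.simpleIntegral g x) ≤ 4 * K * M := by
  classical
  have hsum : μ.simpleIntegral g x = ∑ c : g.range, (c : ℂ) • μ (g ⁻¹' {(c : ℂ)}) x := by
    rw [simpleIntegral, sum_apply, ← Finset.sum_coe_sort]
    rfl
  rw [hsum]
  refine seminorm_sum_complex_smul_le p _ (fun I => ?_) hK fun ⟨c, hc⟩ => ?_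
  · have hI : μ (g ⁻¹' I.map (.subtype _)) x = ∑ c ∈ I, μ (g ⁻¹' {(c : ℂ)}) x := by
      rw [apply_preimage_finset, Finset.sum_map, sum_apply]
      rfl
    exact hI ▸ hM _ (g.measurableSet_preimage _)
  · obtain ⟨s, rfl⟩ := SimpleFunc.mem_range.1 hc
    exact hg s

end FiniteAdditivity

end SpectralMeasure

section SimpleApproximation

open MeasureTheory TopologicalSpace

theorem tendstoUniformlyOn_nearestPt_denseSeq {E : Type*} [PseudoEMetricSpace E]
    [MeasurableSpace E] [OpensMeasurableSpace E] [SeparableSpace E] [Nonempty E] {K : Set E}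
    (hK : IsCompact K) :
    TendstoUniformlyOn (fun n => SimpleFunc.nearestPt (denseSeq E) n) id atTop K := by
  rw [← tendstoLocallyUniformlyOn_iff_tendstoUniformlyOn_of_compact hK,
    EMetric.tendstoLocallyUniformlyOn_iff]
  intro ε hε x _
  have hε2 : 0 < ε / 2 := ENNReal.half_pos hε.ne'
  obtain ⟨k, hk⟩ := (denseRange_denseSeq E).exists_mem_open Metric.isOpen_eball
    ⟨x, Metric.mem_eball_self hε2⟩
  refine ⟨Metric.eball x (ε / 2), mem_nhdsWithin_of_mem_nhds (Metric.eball_mem_nhds x hε2), ?_⟩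
  filter_upwards [eventually_ge_atTop k] with n hn y hy
  rw [edist_comm]
  calc _ ≤ edist (denseSeq E k) y := SimpleFunc.edist_nearestPt_le _ y hn
    _ ≤ edist (denseSeq E k) x + edist y x := edist_triangle_right _ _ _
    _ < ε := ENNReal.add_halves ε ▸ ENNReal.add_lt_add hk hy

theorem exists_simpleFunc_tendstoUniformly {S E : Type*} [MeasurableSpace S]
    [PseudoEMetricSpace E] [MeasurableSpace E] [OpensMeasurableSpace E] [SeparableSpace E]
    [Nonempty E] {h : S → E} (hm : Measurable h) {K : Set E} (hK : IsCompact K)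
    (hh : ∀ s, h s ∈ K) :
    ∃ g : ℕ → SimpleFunc S E, TendstoUniformly (fun n s => g n s) h atTop := by
  refine ⟨fun n => (SimpleFunc.nearestPt (denseSeq E) n).comp h hm, ?_⟩
  have := (tendstoUniformlyOn_nearestPt_denseSeq hK).comp h
  rwa [Set.eq_univ_of_forall (s := h ⁻¹' K) hh, tendstoUniformlyOn_univ] at this

theorem exists_norm_le_of_tendstoUniformly {S E : Type*} [MeasurableSpace S]
    [NormedAddCommGroup E] {g : ℕ → SimpleFunc S E} {h : S → E}
    (hg : TendstoUniformly (fun n s => g n s) h atTop) :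
    ∃ K : ℝ, 0 ≤ K ∧ (∀ s, ‖h s‖ ≤ K) ∧ ∀ᶠ n in atTop, ∀ s, ‖g n s‖ ≤ K := by
  have hclose := Metric.tendstoUniformly_iff.1 hg 1 one_pos
  obtain ⟨N, hN⟩ := hclose.exists
  obtain ⟨C, hC⟩ := (g N).exists_forall_norm_le
  have hh (s : S) : ‖h s‖ ≤ |C| + 1 := by
    linarith [norm_le_norm_add_const_of_dist_le (hN s).le, hC s, le_abs_self C]
  refine ⟨|C| + 2, by positivity, fun s => (hh s).trans (by linarith), ?_⟩
  filter_upwards [hclose] with n hn s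
  linarith [norm_le_norm_add_const_of_dist_le (dist_comm (h s) _ ▸ (hn s).le), hh s]

end SimpleApproximation

namespace SpectralMeasure

open MeasureTheory

variable {S F : Type*} [MeasurableSpace S] [AddCommGroup F] [Module ℂ F] [TopologicalSpace F]
  [IsTopologicalAddGroup F] [ContinuousSMul ℂ F] {μ : SpectralMeasure S F} {h k : S → ℂ}
  {T T' : F →L[ℂ] F}

section Integral

theorem hasIntegral_simple (μ : SpectralMeasure S F) (g : SimpleFunc S ℂ) :
    μ.HasIntegral g (μ.simpleIntegral g) :=
  ⟨fun _ => g, Metric.tendstoUniformly_iff.2 fun ε hε => by simp [hε], fun _ => tendsto_const_nhds⟩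

theorem HasIntegral.measurable (hT : μ.HasIntegral h T) : Measurable h := by
  obtain ⟨g, hg, -⟩ := hT
  exact measurable_of_tendsto_metrizable (fun n => (g n).measurable)
    (tendsto_pi_nhds.2 fun s => hg.tendsto_at s)

theorem HasIntegral.exists_bound (hT : μ.HasIntegral h T) : ∃ K : ℝ, ∀ s, ‖h s‖ ≤ K := by
  obtain ⟨g, hg, -⟩ := hT
  obtain ⟨K, -, hK, -⟩ := exists_norm_le_of_tendstoUniformly hg
  exact ⟨K, hK⟩

variable [SeparatingDual ℂ F]

theorem hasIntegral_indicator_const (μ : SpectralMeasure S F) {A : Set S} (hA : MeasurableSet A)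
    (c : ℂ) : μ.HasIntegral (A.indicator fun _ => c) (c • μ A) := by
  classical
  have := μ.hasIntegral_simple (.piecewise A hA (.const S c) (.const S 0))
  rw [simpleIntegral_piecewise_const, SimpleFunc.coe_piecewise] at this
  rwa [← Set.piecewise_eq_indicator]

theorem hasIntegral_indicator_one (μ : SpectralMeasure S F) {A : Set S} (hA : MeasurableSet A) :
    μ.HasIntegral (A.indicator fun _ => 1) (μ A) := by
  simpa using μ.hasIntegral_indicator_const hA 1

theorem hasIntegral_const (μ : SpectralMeasure S F) (c : ℂ) :
    μ.HasIntegral (fun _ => c) (c • ContinuousLinearMap.id ℂ F) := by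
  simpa [μ.map_univ] using μ.hasIntegral_indicator_const MeasurableSet.univ c

theorem HasIntegral.add (hT : μ.HasIntegral h T) (hT' : μ.HasIntegral k T') :
    μ.HasIntegral (fun s => h s + k s) (T + T') := by
  obtain ⟨g, hg, hgT⟩ := hT
  obtain ⟨g', hg', hgT'⟩ := hT'
  refine ⟨fun n => g n + g' n, hg.add hg', fun x => ?_⟩
  simp only [simpleIntegral_add]
  exact (hgT x).add (hgT' x)

theorem HasIntegral.const_mul (hT : μ.HasIntegral h T) (c : ℂ) :
    μ.HasIntegral (fun s => c * h s) (c • T) := by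
  obtain ⟨g, hg, hgT⟩ := hT
  refine ⟨fun n => c • g n, (uniformContinuous_const_smul c).comp_tendstoUniformly hg,
    fun x => ?_⟩
  simp only [simpleIntegral_smul]
  exact (hgT x).const_smul c

theorem HasIntegral.sub (hT : μ.HasIntegral h T) (hT' : μ.HasIntegral k T') :
    μ.HasIntegral (fun s => h s - k s) (T - T') := by
  simpa [sub_eq_add_neg] using hT.add (hT'.const_mul (-1))

theorem HasIntegral.sum {ι : Type*} {s : Finset ι} {h : ι → S → ℂ} {T : ι → F →L[ℂ] F}
    (hT : ∀ i ∈ s, μ.HasIntegral (h i) (T i)) :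
    μ.HasIntegral (fun x => ∑ i ∈ s, h i x) (∑ i ∈ s, T i) := by
  classical
  induction s using Finset.induction_on with
  | empty => simpa using μ.hasIntegral_const 0
  | insert j s hj ih =>
    simpa only [Finset.sum_insert hj] using
      (hT j (Finset.mem_insert_self _ _)).add (ih fun i hi => hT i (Finset.mem_insert_of_mem hi))

theorem HasIntegral.seminorm_apply_le (hT : μ.HasIntegral h T) {p : Seminorm ℂ F}
    (hp : Continuous p) {K M : ℝ} (hK : 0 ≤ K) (hh : ∀ s, ‖h s‖ ≤ K) {x : F}
    (hM : ∀ A, MeasurableSet A → p (μ A x) ≤ M) : p (T x) ≤ 4 * K * M := by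
  obtain ⟨g, hg, hgT⟩ := hT
  have hle : ∀ᶠ ε in 𝓝[>] (0 : ℝ), p (T x) ≤ 4 * (K + ε) * M := by
    filter_upwards [self_mem_nhdsWithin] with ε hε
    refine le_of_tendsto ((hp.tendsto _).comp (hgT x)) ?_
    filter_upwards [Metric.tendstoUniformly_iff.1 hg ε hε] with n hn
    refine μ.seminorm_simpleIntegral_le p hM (add_nonneg hK (le_of_lt hε)) fun s => ?_
    have := norm_le_norm_add_const_of_dist_le (dist_comm (h s) _ ▸ (hn s).le)
    linarith [hh s]
  have hlim : Tendsto (fun ε : ℝ => 4 * (K + ε) * M) (𝓝[>] 0) (𝓝 (4 * (K + 0) * M)) :=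
    tendsto_nhdsWithin_of_tendsto_nhds (by fun_prop : Continuous fun ε : ℝ =>
      4 * (K + ε) * M).continuousAt
  simpa using ge_of_tendsto hlim hle

variable [PolynormableSpace ℂ F]

theorem tendsto_integral_apply_zero (hμ : μ.IsEquicontinuous) {ι : Type*} {l : Filter ι}
    {d : ι → S → ℂ} {T : ι → F →L[ℂ] F} (hT : ∀ i, μ.HasIntegral (d i) (T i)) {K : ℝ}
    (hK : 0 ≤ K) (hd : ∀ᶠ i in l, ∀ s, ‖d i s‖ ≤ K) {y : ι → F} (hy : Tendsto y l (𝓝 0)) :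
    Tendsto (fun i => T i (y i)) l (𝓝 0) := by
  rw [tendsto_zero_iff_forall_continuous_seminorm (𝕜 := ℂ)] at hy ⊢
  intro p hp
  obtain ⟨q, hq, hpq⟩ := hμ p hp
  have hlim : Tendsto (fun i => 4 * K * q (y i)) l (𝓝 0) := by
    simpa using (hy q hq).const_mul (4 * K)
  refine squeeze_zero' (.of_forall fun i => apply_nonneg p _) ?_ hlim
  filter_upwards [hd] with i hi
  exact (hT i).seminorm_apply_le hp hK hi fun A hA => hpq A hA _

theorem HasIntegral.mul (hμ : μ.IsEquicontinuous) (hT : μ.HasIntegral h T)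
    (hT' : μ.HasIntegral k T') : μ.HasIntegral (fun s => h s * k s) (T ∘L T') := by
  obtain ⟨g, hg, hgT⟩ := hT
  obtain ⟨g', hg', hgT'⟩ := hT'
  obtain ⟨K, hK, hh, hgK⟩ := exists_norm_le_of_tendstoUniformly hg
  obtain ⟨K', -, hk, hgK'⟩ := exists_norm_le_of_tendstoUniformly hg'
  refine ⟨fun n => g n * g' n, ?_, fun x => ?_⟩
  · have hmul : UniformContinuousOn (fun z : ℂ × ℂ => z.1 * z.2)
        (Metric.closedBall 0 K ×ˢ Metric.closedBall 0 K') :=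
      ((isCompact_closedBall _ _).prod (isCompact_closedBall _ _)).uniformContinuousOn_of_continuous
        continuous_mul.continuousOn
    have hpair : TendstoUniformly (fun n s => (g n s, g' n s)) (fun s => (h s, k s)) atTop :=
      fun v hv => tendsto_diag.eventually (hg.prodMk hg' v hv)
    refine hmul.comp_tendstoUniformly_eventually ?_ (fun s => ?_) hpair
    · filter_upwards [hgK, hgK'] with n hn hn' s
      simp [hn s, hn' s]
    · simp [hh s, hk s]
  · have hdiff : Tendsto (fun n => μ.simpleIntegral (g n) (μ.simpleIntegral (g' n) x - T' x))
        atTop (𝓝 0) :=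
      tendsto_integral_apply_zero hμ (fun n => μ.hasIntegral_simple (g n)) hK hgK
        (tendsto_sub_nhds_zero_iff.2 (hgT' x))
    simpa [simpleIntegral_mul] using hdiff.add (hgT (T' x))

theorem HasIntegral.pow (hμ : μ.IsEquicontinuous) (hT : μ.HasIntegral h T) (n : ℕ) :
    μ.HasIntegral (fun s => h s ^ n) (T ^ n) := by
  induction n with
  | zero => simpa using! μ.hasIntegral_const 1
  | succ n ih => simpa only [pow_succ] using! ih.mul hμ hT

end Integral

section BoundedConvergence

variable [PolynormableSpace ℂ F]

theorem IsEquicontinuous.isClosed_setOf_tendsto_zero (hμ : μ.IsEquicontinuous) {ι : Type*}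
    {l : Filter ι} {A : ι → Set S} (hA : ∀ i, MeasurableSet (A i)) :
    IsClosed {x | Tendsto (fun i => μ (A i) x) l (𝓝 0)} := by
  let _ := IsTopologicalAddGroup.rightUniformSpace F
  have := isUniformAddGroup_of_addCommGroup (G := F)
  have huniform : UniformEquicontinuous fun i => (μ (A i) : F → F) := by
    refine ((PolynormableSpace.withSeminorms ℂ F)
      |>.uniformEquicontinuous_iff_exists_continuous_seminorm
        fun i => (μ (A i)).toLinearMap).2 fun ⟨p, hp⟩ => ?_
    obtain ⟨q, hq, hpq⟩ := hμ p hp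
    exact ⟨q, hq, fun i => hpq _ (hA i)⟩
  exact huniform.equicontinuous.isClosed_setOfPred_tendsto continuous_const

variable [SeparatingDual ℂ F]

theorem IsEquicontinuous.tendsto_apply_of_antitone (hμ : μ.IsEquicontinuous) {A : ℕ → Set S}
    (hA : Antitone A) (hm : ∀ n, MeasurableSet (A n)) (hempty : ⋂ n, A n = ∅) (x : F) :
    Tendsto (fun n => μ (A n) x) atTop (𝓝 0) := by
  have : LocallyConvexSpace ℝ F := (PolynormableSpace.withSeminorms ℂ F).toLocallyConvexSpace
  have hconvex : Convex ℝ {y | Tendsto (fun n => μ (A n) y) atTop (𝓝 0)} :=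
    fun y hy z hz a b _ _ _ => by
      have h (c : ℝ) (v : F) : c • v = (c : ℂ) • v := (Complex.coe_smul c v).symm
      simp only [h, Set.mem_ofPred_eq, map_add, map_smul]
      simpa using (Tendsto.const_smul hy (a : ℂ)).add (Tendsto.const_smul hz (b : ℂ))
  -- Weakly, `x` is the limit of the vectors `μ(A n)ᶜ x`, which `μ(A m)` kills for `m ≥ n`.
  refine mem_of_isClosed_of_tendsto_dual (𝕜 := ℂ) (l := atTop) hconvex
    (hμ.isClosed_setOf_tendsto_zero hm) (u := fun n => μ (A n)ᶜ x) (fun n => ?_) fun φ => ?_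
  · refine tendsto_const_nhds.congr' ?_
    filter_upwards [eventually_ge_atTop n] with m hnm
    rw [← ContinuousLinearMap.comp_apply, ← μ.map_inter _ _ (hm m) (hm n).compl,
      ← Set.sdiff_eq, Set.sdiff_eq_empty.2 (hA hnm), μ.apply_empty, zero_apply]
  · have hlim := (μ.scalarMeasure x φ).tendsto_vectorMeasure_iInter_atTop_nat hA hm
    simp only [hempty, VectorMeasure.empty, μ.scalarMeasure_apply x φ (hm _)] at hlim
    simpa [μ.apply_compl (hm _)] using hlim.const_sub (φ x)

theorem HasIntegral.seminorm_apply_le_add (hμ : μ.IsEquicontinuous) (hT : μ.HasIntegral h T)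
    {p q : Seminorm ℂ F} (hp : Continuous p)
    (hpq : ∀ A, MeasurableSet A → ∀ x, p (μ A x) ≤ q x) {K δ : ℝ} (hK : 0 ≤ K) (hδ : 0 ≤ δ)
    (hhK : ∀ s, ‖h s‖ ≤ K) {A : Set S} (hA : MeasurableSet A) (hhδ : ∀ s ∉ A, ‖h s‖ ≤ δ) (x : F) :
    p (T x) ≤ 4 * K * q (μ A x) + 4 * δ * q x := by
  have hsplit : T x = T (μ A x) + T (μ Aᶜ x) := by simp [μ.apply_compl hA]
  rw [hsplit]
  refine (map_add_le_add p _ _).trans (add_le_add ?_ ?_)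
  · exact hT.seminorm_apply_le hp hK hhK fun B hB => hpq B hB _
  · refine (hT.mul hμ (μ.hasIntegral_indicator_one hA.compl)).seminorm_apply_le hp hδ (fun s => ?_)
      fun B hB => hpq B hB x
    by_cases hs : s ∈ A <;> simp [hs, hδ, hhδ]

theorem IsEquicontinuous.tendsto_apply_iUnion_lt_norm (hμ : μ.IsEquicontinuous) {d : ℕ → S → ℂ}
    (hm : ∀ n, Measurable (d n)) (hd : ∀ s, Tendsto (fun n => d n s) atTop (𝓝 0)) {δ : ℝ}
    (hδ : 0 < δ) (x : F) :
    Tendsto (fun n => μ (⋃ m ≥ n, {s | δ < ‖d m s‖}) x) atTop (𝓝 0) := by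
  refine hμ.tendsto_apply_of_antitone
    (fun n n' hn => Set.biUnion_subset_biUnion_left fun m => hn.trans)
    (fun n => .biUnion (Set.to_countable _) fun m _ =>
      measurableSet_lt measurable_const (hm m).norm)
    (Set.eq_empty_of_forall_notMem fun s hs => ?_) x
  obtain ⟨n, hn⟩ := eventually_atTop.1 ((tendsto_zero_iff_norm_tendsto_zero.1 (hd s)).eventually
    (gt_mem_nhds hδ))
  obtain ⟨m, hm, hlt⟩ := Set.mem_iUnion₂.1 (Set.mem_iInter.1 hs n)
  exact lt_asymm hlt (hn m hm)

theorem tendsto_integral_apply_of_tendsto_zero (hμ : μ.IsEquicontinuous) {d : ℕ → S → ℂ}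
    {T : ℕ → F →L[ℂ] F} (hT : ∀ n, μ.HasIntegral (d n) (T n)) {K : ℝ}
    (hK : ∀ᶠ n in atTop, ∀ s, ‖d n s‖ ≤ K) (hd : ∀ s, Tendsto (fun n => d n s) atTop (𝓝 0))
    (x : F) : Tendsto (fun n => T n x) atTop (𝓝 0) := by
  rw [tendsto_zero_iff_forall_continuous_seminorm (𝕜 := ℂ)]
  intro p hp
  obtain ⟨q, hq, hpq⟩ := hμ p hp
  refine tendsto_order.2 ⟨fun a ha => .of_forall fun n => ha.trans_le (apply_nonneg p _),
    fun ε hε => ?_⟩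
  obtain ⟨δ, hδ, hδε⟩ := exists_pos_mul_lt hε (4 * q x)
  have hlim := ((tendsto_zero_iff_forall_continuous_seminorm.1 (hμ.tendsto_apply_iUnion_lt_norm
    (fun n => (hT n).measurable) hd hδ x) q hq).const_mul (4 * |K|)).add_const (4 * δ * q x)
  have hlt : 4 * |K| * 0 + 4 * δ * q x < ε := by linarith
  filter_upwards [hK, hlim.eventually (gt_mem_nhds hlt)] with n hn hlt
  refine ((hT n).seminorm_apply_le_add hμ hp hpq (abs_nonneg K) hδ.le
    (fun s => (hn s).trans (le_abs_self K)) (.biUnion (Set.to_countable _) fun m _ =>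
      measurableSet_lt measurable_const (hT m).measurable.norm) (fun s hs => ?_) x).trans_lt hlt
  exact not_lt.1 fun hlt => hs (Set.mem_iUnion₂_of_mem (le_refl n) hlt)

theorem tendsto_integral_apply (hμ : μ.IsEquicontinuous) {d : ℕ → S → ℂ}
    {D : ℕ → F →L[ℂ] F} (hD : ∀ n, μ.HasIntegral (d n) (D n)) (hT : μ.HasIntegral h T) {K : ℝ}
    (hK : ∀ᶠ n in atTop, ∀ s, ‖d n s‖ ≤ K) (hd : ∀ s, Tendsto (fun n => d n s) atTop (𝓝 (h s)))
    (x : F) : Tendsto (fun n => D n x) atTop (𝓝 (T x)) := by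
  obtain ⟨C, hC⟩ := hT.exists_bound
  refine tendsto_sub_nhds_zero_iff.1 ?_
  refine tendsto_integral_apply_of_tendsto_zero hμ (fun n => (hD n).sub hT) (K := K + C) ?_
    (fun s => tendsto_sub_nhds_zero_iff.2 (hd s)) x
  filter_upwards [hK] with n hn s
  exact (norm_sub_le _ _).trans (add_le_add (hn s) (hC s))

end BoundedConvergence

end SpectralMeasure

section Differentiation

open MeasureTheory Module

variable {E : Type*} [NormedAddCommGroup E] [NormedSpace ℝ E] [FiniteDimensional ℝ E]
  [MeasurableSpace E] [BorelSpace E] {B : Set E}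

theorem measure_eq_zero_of_measure_closedBall_le (m : Measure E) [IsLocallyFiniteMeasure m]
    (hB : ∀ ξ ∈ B, ∃ C : ℝ, ∀ r : ℝ, 0 < r →
      m (Metric.closedBall ξ r) ≤ ENNReal.ofReal (C * r ^ (finrank ℝ E + 1))) :
    m B = 0 := by
  have : ProperSpace E := FiniteDimensional.proper_real E
  let lam : Measure E := Measure.addHaar
  have hunit : lam (Metric.ball 0 1) ≠ 0 := (Metric.measure_ball_pos lam 0 one_pos).ne'
  suffices h : ∀ᵐ ξ ∂m, ξ ∉ B by simpa [ae_iff] using h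
  -- At such points the density of Lebesgue measure with respect to `m` would be infinite.
  filter_upwards [Besicovitch.ae_tendsto_rnDeriv lam m, Measure.rnDeriv_lt_top lam m]
    with ξ hξ hfin hξB
  obtain ⟨C, hC⟩ := hB ξ hξB
  have hlim : Tendsto (fun r : ℝ => lam (Metric.ball 0 1) / ENNReal.ofReal (C * r))
      (𝓝[>] 0) (𝓝 (lam (Metric.ball 0 1) / ENNReal.ofReal (C * 0))) :=
    ENNReal.Tendsto.const_div (ENNReal.tendsto_ofReal (tendsto_nhdsWithin_of_tendsto_nhds
      (tendsto_id.const_mul C))) (.inl ENNReal.ofReal_ne_top)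
  rw [mul_zero, ENNReal.ofReal_zero, ENNReal.div_zero hunit] at hlim
  refine hfin.not_ge (le_of_tendsto_of_tendsto hlim hξ ?_)
  filter_upwards [self_mem_nhdsWithin] with r hr
  have hpow : 0 < r ^ finrank ℝ E := pow_pos hr _
  calc lam (Metric.ball 0 1) / ENNReal.ofReal (C * r)
      = lam (Metric.closedBall ξ r) / ENNReal.ofReal (C * r ^ (finrank ℝ E + 1)) := by
        rw [Measure.addHaar_closedBall lam ξ (le_of_lt hr), pow_succ', ← mul_assoc,
          mul_comm (C * r), ENNReal.ofReal_mul hpow.le, ENNReal.mul_div_mul_left _ _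
          (ENNReal.ofReal_pos.2 hpow).ne' ENNReal.ofReal_ne_top]
    _ ≤ lam (Metric.closedBall ξ r) / m (Metric.closedBall ξ r) :=
        ENNReal.div_le_div_left (hC r hr) _

theorem signedMeasure_totalVariation_le {X : Type*} [MeasurableSpace X] (ν : SignedMeasure X)
    {A : Set X} (hA : MeasurableSet A) {M : ℝ} (hM : ∀ t ⊆ A, MeasurableSet t → ‖ν t‖ ≤ M) :
    ν.totalVariation A ≤ ENNReal.ofReal (2 * M) := by
  rw [ν.totalVariation_eq_variation, ENNReal.ofReal_mul zero_le_two, ENNReal.ofReal_ofNat]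
  refine le_of_forall_lt fun a ha => ?_
  obtain ⟨t, htA, ht, hlt⟩ := ν.exists_subset_lt_enorm_apply_of_lt_variation hA ha
  rw [← ofReal_norm] at hlt
  exact hlt.trans_le (by gcongr; exact hM t htA ht)

theorem vectorMeasure_apply_eq_zero_of_norm_apply_le {V : Type*} [NormedAddCommGroup V]
    [NormedSpace ℝ V] (ν : VectorMeasure E V)
    (h : ∀ ξ ∈ B, ∃ C : ℝ, ∀ r : ℝ, 0 < r → ∀ A ⊆ Metric.closedBall ξ r, MeasurableSet A →
      ‖ν A‖ ≤ C * r ^ (finrank ℝ E + 1)) :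
    ν B = 0 := by
  refine SeparatingDual.eq_zero_of_forall_dual_eq_zero (R := ℝ) fun φ => ?_
  let νφ : SignedMeasure E := ν.mapRange φ.toAddMonoidHom φ.continuous
  refine νφ.null_of_totalVariation_zero
    (measure_eq_zero_of_measure_closedBall_le _ fun ξ hξ => ?_)
  obtain ⟨C, hC⟩ := h ξ hξ
  refine ⟨2 * (‖φ‖ * C), fun r hr => ?_⟩
  rw [mul_assoc]
  refine signedMeasure_totalVariation_le νφ Metric.isClosed_closedBall.measurableSet
    fun A hA hAm => (φ.le_opNorm _).trans ?_
  rw [mul_assoc]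
  exact mul_le_mul_of_nonneg_left (hC r hr A hA hAm) (norm_nonneg φ)

end Differentiation

namespace SpectralMeasure

open MeasureTheory

variable {S F : Type*} [MeasurableSpace S] [AddCommGroup F] [Module ℂ F] [TopologicalSpace F]
  [IsTopologicalAddGroup F] [ContinuousSMul ℂ F] [PolynormableSpace ℂ F] [SeparatingDual ℂ F]
  {μ : SpectralMeasure S F} {f : S → ℂ} {U : F →L[ℂ] F}

section Support

theorem exists_seminorm_apply_preimage_le_pow (hμ : μ.IsEquicontinuous)
    (hU : μ.HasIntegral f U) {ξ : ℂ} (hξ : IsInducing (shiftedOp U ξ)) {p : Seminorm ℂ F}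
    (hp : Continuous p) (n : ℕ) (x : F) :
    ∃ C : ℝ, ∀ r : ℝ, 0 < r → ∀ A ⊆ Metric.closedBall ξ r, MeasurableSet A →
      p (μ (f ⁻¹' A) x) ≤ C * r ^ n := by
  have hW : μ.HasIntegral (fun s => ξ - f s) (shiftedOp U ξ) := (μ.hasIntegral_const ξ).sub hU
  have hpow : IsInducing (shiftedOp U ξ ^ n : F →L[ℂ] F) := by
    induction n with
    | zero => exact .id
    | succ n ih => exact ih.comp hξ
  obtain ⟨q, hq, hpq⟩ := Seminorm.exists_le_comp_of_isInducing hp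
    (f := (shiftedOp U ξ ^ n : F →L[ℂ] F).toLinearMap) hpow
  obtain ⟨q', -, hq'⟩ := hμ q hq
  refine ⟨4 * q' x, fun r hr A hA hAm => (hpq _).trans ?_⟩
  rw [mul_right_comm]
  refine ((hW.pow hμ n).mul hμ (μ.hasIntegral_indicator_one (hU.measurable hAm))).seminorm_apply_le
    hq (by positivity) (fun s => ?_) fun B hB => hq' B hB x
  by_cases hs : f s ∈ A
  · have hle : ‖ξ - f s‖ ≤ r := by simpa [dist_eq_norm'] using hA hs
    simpa [Set.indicator_of_mem (show s ∈ f ⁻¹' A from hs)] using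
      pow_le_pow_left₀ (norm_nonneg _) hle n
  · simp [Set.indicator_of_notMem (show s ∉ f ⁻¹' A from hs), hr.le]

theorem apply_preimage_eq_zero (hμ : μ.IsEquicontinuous) (hU : μ.HasIntegral f U) {B : Set ℂ}
    (hB : MeasurableSet B) (hBU : B ⊆ lcResolventSet U) : μ (f ⁻¹' B) = 0 := by
  ext x
  refine SeparatingDual.eq_zero_of_forall_dual_eq_zero (R := ℂ) fun φ => ?_
  have happly {A : Set ℂ} (hA : MeasurableSet A) :
      (μ.map f hU.measurable).scalarMeasure x φ A = φ (μ (f ⁻¹' A) x) :=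
    (μ.map f hU.measurable).scalarMeasure_apply x φ hA
  rw [← happly hB]
  refine vectorMeasure_apply_eq_zero_of_norm_apply_le _ fun ξ hξ => ?_
  obtain ⟨C, hC⟩ := exists_seminorm_apply_preimage_le_pow hμ hU (hBU hξ).2.isInducing
    (p := (normSeminorm ℂ ℂ).comp φ.toLinearMap) φ.continuous.norm (Module.finrank ℝ ℂ + 1) x
  exact ⟨C, fun r hr A hA hAm => happly hAm ▸ hC r hr A hA hAm⟩

theorem apply_preimage_inter (hμ : μ.IsEquicontinuous) (hU : μ.HasIntegral f U) {A B : Set ℂ}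
    (hA : MeasurableSet A) (hB : MeasurableSet B) (hAB : A ∩ lcSpectrum U ⊆ B) :
    μ (f ⁻¹' (A ∩ B)) = μ (f ⁻¹' A) := by
  have hnull : μ (f ⁻¹' (A \ B)) = 0 :=
    apply_preimage_eq_zero hμ hU (hA.diff hB) fun z hz =>
      not_not.1 fun hzU => hz.2 (hAB ⟨hz.1, hzU⟩)
  conv_rhs => rw [← Set.inter_union_sdiff A B, Set.preimage_union,
    μ.apply_union (hU.measurable (hA.inter hB)) (hU.measurable (hA.diff hB))
      (Set.disjoint_sdiff_inter.symm.preimage f), hnull, add_zero]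

theorem apply_preimage_congr (hμ : μ.IsEquicontinuous) (hU : μ.HasIntegral f U) {A B : Set ℂ}
    (hA : MeasurableSet A) (hB : MeasurableSet B)
    (hAB : A ∩ lcSpectrum U = B ∩ lcSpectrum U) : μ (f ⁻¹' A) = μ (f ⁻¹' B) := by
  rw [← apply_preimage_inter hμ hU hA hB (hAB.subset.trans Set.inter_subset_left), Set.inter_comm,
    apply_preimage_inter hμ hU hB hA (hAB.superset.trans Set.inter_subset_left)]

end Support

end SpectralMeasure

section Averages

variable {𝕜 : Type*} [RCLike 𝕜] {w : 𝕜}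

theorem norm_average_pow_le_one (hw : ‖w‖ ≤ 1) (n : ℕ) :
    ‖(n : 𝕜)⁻¹ * ∑ k ∈ Finset.range n, w ^ k‖ ≤ 1 := by
  have hsum : ‖∑ k ∈ Finset.range n, w ^ k‖ ≤ n := by
    simpa using norm_sum_le_of_le (Finset.range n) (f := fun k => w ^ k) (n := fun _ => (1 : ℝ))
      fun k _ => (norm_pow w k).trans_le (pow_le_one₀ (norm_nonneg w) hw)
  rw [norm_mul, norm_inv, RCLike.norm_natCast]
  exact (mul_le_mul_of_nonneg_left hsum (by positivity)).trans inv_mul_le_one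

theorem tendsto_average_pow (hw : ‖w‖ ≤ 1) :
    Tendsto (fun n : ℕ => (n : 𝕜)⁻¹ * ∑ k ∈ Finset.range n, w ^ k) atTop
      (𝓝 (({1} : Set 𝕜).indicator 1 w)) := by
  by_cases h : w = 1
  · refine tendsto_const_nhds.congr' ?_
    filter_upwards [eventually_ne_atTop 0] with n hn
    simp [h, hn]
  · have hlim : Tendsto (fun n : ℕ => (n : ℝ)⁻¹ * (2 / ‖w - 1‖)) atTop (𝓝 0) := by
      simpa using tendsto_inv_atTop_nhds_zero_nat.mul_const (2 / ‖w - 1‖)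
    rw [Set.indicator_of_notMem (by simpa using h)]
    refine squeeze_zero_norm (fun n => ?_) hlim
    rw [norm_mul, norm_inv, RCLike.norm_natCast, geom_sum_eq h, norm_div]
    gcongr
    calc ‖w ^ n - 1‖ ≤ ‖w‖ ^ n + 1 := by simpa using norm_sub_le (w ^ n) 1
      _ ≤ 2 := by linarith [pow_le_one₀ (n := n) (norm_nonneg w) hw]

end Averages

section ExteriorQuotient

variable {𝕜 : Type*} [NormedField 𝕜]

/-- The multiplier `z ↦ l / z`, cut off to `0` on the disc `‖z‖ < ‖l‖` so that it is bounded by `1`.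
The averages of its powers single out the point `z = l`. -/
noncomputable def exteriorQuotient (l : 𝕜) : 𝕜 → 𝕜 :=
  (Metric.ball 0 ‖l‖)ᶜ.indicator fun z => l / z

theorem norm_exteriorQuotient_le_one (l z : 𝕜) : ‖exteriorQuotient l z‖ ≤ 1 := by
  by_cases hz : ‖l‖ ≤ ‖z‖
  · rw [exteriorQuotient, Set.indicator_of_mem (by simpa using hz), norm_div]
    exact div_le_one_of_le₀ hz (norm_nonneg _)
  · rw [exteriorQuotient, Set.indicator_of_notMem (by simpa using hz), norm_zero]
    exact zero_le_one

theorem preimage_exteriorQuotient_one (l : 𝕜) : exteriorQuotient l ⁻¹' {1} = {l} \ {0} := by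
  ext z
  rw [Set.mem_preimage, Set.mem_singleton_iff, Set.mem_sdiff, Set.mem_singleton_iff,
    Set.mem_singleton_iff]
  by_cases hz : ‖l‖ ≤ ‖z‖
  · rw [exteriorQuotient, Set.indicator_of_mem (by simpa using hz)]
    by_cases h0 : z = 0
    · simp [h0]
    · simp [h0, div_eq_one_iff_eq, eq_comm]
  · rw [exteriorQuotient, Set.indicator_of_notMem (by simpa using hz)]
    have hne : z ≠ l := fun h => hz (h ▸ le_rfl)
    simp [hne]

theorem mul_exteriorQuotient (l z : 𝕜) :
    z * exteriorQuotient l z = (Metric.ball 0 ‖l‖)ᶜ.indicator (fun _ => l) z := by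
  by_cases hz : z = 0
  · by_cases hl : l = 0 <;> simp [hz, hl]
  · by_cases hzl : ‖l‖ ≤ ‖z‖ <;> simp [exteriorQuotient, hz, hzl, mul_div_cancel₀]

end ExteriorQuotient

namespace SpectralMeasure

open MeasureTheory

variable {S F : Type*} [MeasurableSpace S] [AddCommGroup F] [Module ℂ F] [TopologicalSpace F]
  [IsTopologicalAddGroup F] [ContinuousSMul ℂ F] [PolynormableSpace ℂ F] [SeparatingDual ℂ F]
  {μ : SpectralMeasure S F} {f w : S → ℂ} {U T V : F →L[ℂ] F}

section Operators

theorem tendsto_averageOp (hμ : μ.IsEquicontinuous) (hV : μ.HasIntegral w V)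
    (hw : ∀ s, ‖w s‖ ≤ 1) (x : F) :
    Tendsto (fun n => averageOp n V x) atTop (𝓝 (μ (w ⁻¹' {1}) x)) :=
  tendsto_integral_apply hμ
    (fun n => (HasIntegral.sum fun k _ => hV.pow hμ k).const_mul (n : ℂ)⁻¹)
    (μ.hasIntegral_indicator_one (hV.measurable (measurableSet_singleton 1)))
    (.of_forall fun n s => norm_average_pow_le_one (hw s) n)
    (fun s => tendsto_average_pow (hw s)) x

theorem HasIntegral.exists_tendsto_apply (hμ : μ.IsEquicontinuous) (hU : μ.HasIntegral f U)
    (hf : μ (f ⁻¹' {0}) = 0) (x : F) :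
    ∃ u : ℕ → F, Tendsto (fun n => U (u n)) atTop (𝓝 x) := by
  have hzero : MeasurableSet (f ⁻¹' {0}) := hU.measurable (measurableSet_singleton 0)
  let g : ℕ → SimpleFunc S ℂ :=
    SimpleFunc.approxOn (fun s => (f s)⁻¹) hU.measurable.inv Set.univ 0 (Set.mem_univ 0)
  have hid := μ.hasIntegral_indicator_one hzero.compl
  rw [μ.apply_compl hzero, hf, sub_zero] at hid
  refine ⟨fun n => μ.simpleIntegral (g n) x, tendsto_integral_apply hμ
    (fun n => hU.mul hμ (μ.hasIntegral_simple (g n))) hid (K := 2)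
    (.of_forall fun n s => ?_) (fun s => ?_) x⟩
  · have hg : ‖g n s‖ ≤ ‖(f s)⁻¹‖ + ‖(f s)⁻¹‖ :=
      SimpleFunc.norm_approxOn_zero_le hU.measurable.inv (Set.mem_univ 0) s n
    calc ‖f s * g n s‖ ≤ ‖f s‖ * (‖(f s)⁻¹‖ + ‖(f s)⁻¹‖) :=
          (norm_mul_le _ _).trans (mul_le_mul_of_nonneg_left hg (norm_nonneg _))
      _ = 2 * (‖f s‖ * ‖f s‖⁻¹) := by rw [norm_inv]; ring
      _ ≤ 2 := by linarith [mul_inv_le_one (a := ‖f s‖)]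
  · have hg : Tendsto (fun n => g n s) atTop (𝓝 (f s)⁻¹) :=
      SimpleFunc.tendsto_approxOn hU.measurable.inv (Set.mem_univ 0) (by simp)
    convert hg.const_mul (f s) using 2
    by_cases hs : f s = 0 <;> simp [hs]

theorem HasIntegral.surjective (hF : LocallySeqWeaklyCompact F) (hμ : μ.IsEquicontinuous)
    (hU : μ.HasIntegral f U) (hf : μ (f ⁻¹' {0}) = 0) (hind : IsInducing U) :
    Function.Surjective U := by
  intro x
  obtain ⟨u, hu⟩ := hU.exists_tendsto_apply hμ hf x
  have hbdd : Bornology.IsVonNBounded ℂ (Set.range u) := by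
    refine isVonNBounded_of_image_of_isInducing (T := U.toLinearMap) hind ?_
    rw [← Set.range_comp]
    let _ := IsTopologicalAddGroup.rightUniformSpace F
    have := isUniformAddGroup_of_addCommGroup (G := F)
    exact hu.isVonNBounded_range ℂ
  obtain ⟨y, k, hk, hy⟩ := hF u hbdd
  refine ⟨y, (SeparatingDual.eq_iff_forall_dual_eq (R := ℂ)).2 fun φ => ?_⟩
  exact tendsto_nhds_unique (hy (φ ∘L U))
    (((φ.continuous.tendsto x).comp hu).comp hk.tendsto_atTop)

theorem HasIntegral.isInvertible (hF : LocallySeqWeaklyCompact F) (hμ : μ.IsEquicontinuous)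
    (hU : μ.HasIntegral f U) (h0 : 0 ∈ lcResolventSet U) : U.IsInvertible := by
  have hemb : IsEmbedding U := by
    have hneg : Homeomorph.neg F ∘ shiftedOp U 0 = U := by
      ext x
      simp [shiftedOp]
    exact hneg ▸ (Homeomorph.neg F).isEmbedding.comp h0.2
  have hf : μ (f ⁻¹' {0}) = 0 := apply_preimage_eq_zero hμ hU (measurableSet_singleton 0)
    (Set.singleton_subset_iff.2 h0)
  exact isInvertible_of_isEmbedding_of_surjective hemb (hU.surjective hF hμ hf hemb.isInducing)

theorem HasIntegral.inverse_comp (hμ : μ.IsEquicontinuous) (hU : μ.HasIntegral f U)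
    (hinv : U.IsInvertible) (hm : Measurable w) {K : ℝ} (hK : ∀ s, ‖w s‖ ≤ K)
    (hT : μ.HasIntegral (fun s => f s * w s) T) : μ.HasIntegral w (U.inverse ∘L T) := by
  obtain ⟨g, hg⟩ := exists_simpleFunc_tendstoUniformly hm (isCompact_closedBall (0 : ℂ) K)
    fun s => mem_closedBall_zero_iff.2 (hK s)
  obtain ⟨C, -, -, hgC⟩ := exists_norm_le_of_tendstoUniformly hg
  obtain ⟨L, hL⟩ := hU.exists_bound
  have hlim (x : F) : Tendsto (fun n => U (μ.simpleIntegral (g n) x)) atTop (𝓝 (T x)) := by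
    refine tendsto_integral_apply hμ (fun n => hU.mul hμ (μ.hasIntegral_simple (g n))) hT
      (K := L * C) ?_ (fun s => (hg.tendsto_at s).const_mul (f s)) x
    filter_upwards [hgC] with n hn s
    rw [norm_mul]
    exact mul_le_mul (hL s) (hn s) (norm_nonneg _) ((norm_nonneg _).trans (hL s))
  refine ⟨g, hg, fun x => ((U.inverse.continuous.tendsto _).comp (hlim x)).congr fun n => ?_⟩
  exact hinv.inverse_apply_eq.2 rfl

theorem HasIntegral.exteriorQuotient (hμ : μ.IsEquicontinuous) (hU : μ.HasIntegral f U)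
    (hinv : U.IsInvertible) (l : ℂ) :
    μ.HasIntegral (fun s => exteriorQuotient l (f s))
      (l • (U.inverse ∘L μ (f ⁻¹' (Metric.ball 0 ‖l‖)ᶜ))) := by
  have hball : MeasurableSet (Metric.ball (0 : ℂ) ‖l‖)ᶜ := Metric.isOpen_ball.measurableSet.compl
  have hm : Measurable (_root_.exteriorQuotient l) :=
    (measurable_const.div measurable_id).indicator hball
  have hT := μ.hasIntegral_indicator_const (hU.measurable hball) l
  rw [← ContinuousLinearMap.comp_smul]
  refine hU.inverse_comp hμ hinv (hm.comp hU.measurable)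
    (fun s => norm_exteriorQuotient_le_one l (f s)) ?_
  simpa only [mul_exteriorQuotient] using! hT

end Operators

end SpectralMeasure

theorem mainTheorem2_general {F S : Type*} [AddCommGroup F] [Module ℂ F] [TopologicalSpace F]
    [IsTopologicalAddGroup F] [ContinuousSMul ℂ F] [PolynormableSpace ℂ F] [T2Space F]
    (hF : LocallySeqWeaklyCompact F)
    [MeasurableSpace S] (μ : SpectralMeasure S F) (hμ : μ.IsEquicontinuous)
    (f : S → ℂ) (hf : Measurable f) (U : F →L[ℂ] F) (hU : μ.HasIntegral f U)
    (h0 : 0 ∈ lcResolventSet U) (l : ℂ) :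
    U.IsInvertible ∧
      ∀ B : Set ℂ, MeasurableSet B →
        B ∩ lcSpectrum U = {ξ ∈ lcSpectrum U | ‖ξ‖ < ‖l‖} →
        ∀ x : F,
          Tendsto
            (fun n : ℕ => averageOp n
              (l • (U.inverse ∘L (ContinuousLinearMap.id ℂ F - μ.map f hf B))) x)
            atTop (𝓝 (μ.map f hf {l} x)) := by
  have : SeparatingDual ℂ F := separatingDual_of_polynormableSpace
  have hinv := hU.isInvertible hF hμ h0
  refine ⟨hinv, fun B hB hBl x => ?_⟩
  have hball : MeasurableSet (Metric.ball (0 : ℂ) ‖l‖) := Metric.isOpen_ball.measurableSet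
  have hE : ContinuousLinearMap.id ℂ F - μ.map f hf B = μ (f ⁻¹' (Metric.ball 0 ‖l‖)ᶜ) := by
    rw [Set.preimage_compl, μ.apply_compl (hf hball)]
    refine congrArg _ (SpectralMeasure.apply_preimage_congr hμ hU hB hball (hBl.trans ?_))
    ext z
    simp [and_comm]
  have hl : μ.map f hf {l} = μ ((fun s => exteriorQuotient l (f s)) ⁻¹' {1}) := by
    rw [← Function.comp_def, Set.preimage_comp, preimage_exteriorQuotient_one]
    refine SpectralMeasure.apply_preimage_congr hμ hU (measurableSet_singleton l)
      ((measurableSet_singleton l).diff (measurableSet_singleton 0)) ?_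
    ext z
    have hz (h : z ∈ lcSpectrum U) : z ≠ 0 := fun hz => h (hz ▸ h0)
    simp +contextual [hz]
  rw [hE, hl]
  exact SpectralMeasure.tendsto_averageOp hμ (hU.exteriorQuotient hμ hinv l)
    (fun s => norm_exteriorQuotient_le_one l (f s)) x

theorem mainTheorem2
    {F Γ S : Type*} [AddCommGroup F] [Module ℂ F] [TopologicalSpace F]
    [IsTopologicalAddGroup F] [ContinuousSMul ℂ F] [T2Space F]
    [TopologicalSpace.SeparableSpace F]
    (p : SeminormFamily ℂ F Γ) (hp : WithSeminorms p)
    (hF : LocallySeqWeaklyCompact F)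
    [MeasurableSpace S] (μ : SpectralMeasure S F) (hμ : μ.IsEquicontinuous)
    (f : S → ℂ) (hf : Measurable f) (hfb : ∃ M : ℝ, ∀ s, ‖f s‖ ≤ M)
    (U : F →L[ℂ] F) (hU : μ.HasIntegral f U)
    (hmin : HasMinimalPointSpectrum U)
    (hcirc : PointSpectrumOnIsolatedCircles f U)
    (C : ℝ) (hC : 0 < C⁻¹) (hspec : ∀ ξ ∈ lcSpectrum U, C⁻¹ ≤ ‖ξ‖)
    (l : ℂ) (hl : l ∈ pointSpectrum U) :
    U.IsInvertible ∧
      ∀ B : Set ℂ, MeasurableSet B →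
        B ∩ lcSpectrum U = {ξ ∈ lcSpectrum U | ‖ξ‖ < ‖l‖} →
        ∀ x : F,
          Tendsto
            (fun n : ℕ => averageOp n
              (l • (U.inverse ∘L (ContinuousLinearMap.id ℂ F - μ.map f hf B))) x)
            atTop (𝓝 (μ.map f hf {l} x)) := by
  have : PolynormableSpace ℂ F := hp.toPolynormableSpace
  have h0 : 0 ∈ lcResolventSet U := by
    by_contra h
    exact absurd (hspec 0 h) (by simpa using hC)
  exact mainTheorem2_general hF μ hμ f hf U hU h0 l
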